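/- Let $\mathcal H=\mathbb C^d$ be a finite-dimensional Hilbert space, and for every $n\ge 1$ let $\mathcal A_n,\mathcal B_n$ be nonempty convex sets of density operators on $\mathcal H^{\otimes n}$. For density operators $\rho,\sigma$ and $0<\alpha<1$ let $$D_\alpha(\rho\|\sigma)=\frac{1}{\alpha-1}\log_2\operatorname{Tr}\bigl[\rho^{\alpha}\sigma^{1-\alpha}\bigr]\in(-\infty,+\infty]$$ be the Petz Rényi divergence (equal to $+\infty$ when the trace is $0$), and put $$D_\alpha(\mathcal A_n\|\mathcal B_n)=\inf_{\rho\in\mathcal A_n,\ \sigma\in\mathcal B_n}D_\alpha(\rho\|\sigma),\qquad D^\infty_\alpha(\mathcal A\|\mathcal B)=\lim_{n\to\infty}\frac1n D_\alpha(\mathcal A_n\|\mathcal B_n)$$ whenever this limit exists in $[-\infty,+\infty]$. For sequences of states, $D^\infty_\alpha(\{\rho^{(n)}\}\|\{\sigma^{(n)}\})=\lim_{n\to\infty}\frac1nD_\alpha(\rho^{(n)}\|\sigma^{(n)})$. (1) One can choose, for all $n\ge1$ and $\alpha\in[0,1]$, pairs $(\rho_n(\alpha),\sigma_n(\alpha))\in\mathcal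 A_n\times\mathcal B_n$ such that $$D_\alpha(\rho_n(\alpha)\|\sigma_n(\alpha))\le D_\alpha(\mathcal A_n\|\mathcal B_n)+1\qquad\text{for all }\alpha\in(0,1)$$ (for $\alpha\in\{0,1\}$ the pair is an arbitrary element of $\mathcal A_n\times\mathcal B_n$). (2) For every such choice, the averaged operators $$\rho^{(n)}=\frac1{n+1}\sum_{j=0}^{n}\rho_n\!\left(\tfrac jn\right),\qquad \sigma^{(n)}=\frac1{n+1}\sum_{j=0}^{n}\sigma_n\!\left(\tfrac jn\right)$$ satisfy $\rho^{(n)}\in\mathcal A_n$ and $\sigma^{(n)}\in\mathcal B_n$ for all $n\ge1$. Moreover, for every $\alpha\in(0,1)$ such that $D^\infty_\beta(\mathcal A\|\mathcal B)$ exists for all $\beta$ in a neighbourhood of $\alpha$ and $\beta\mapsto D^\infty_\beta(\mathcal A\|\mathcal B)$ is continuous at $\beta=\alpha$, the limit $D^\infty_\alpha(\{\rho^{(n)}\}\|\{\sigma^{(n)}\})$ exists and $$D^\infty_\alpha(\{\rho^{(n)}\}\|\{\sigma^{(n)}\})=D^\infty_\alpha(\mathcal A\|\mathcal B).$$ -/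

import Mathlib

open Set Filter Topology
open scoped ComplexOrder

noncomputable section

/-- Linear operators on `H^{⊗ n}` for the Hilbert space `H = ℂ^ι`, as matrices in the product basis
`e_{i_1} ⊗ ⋯ ⊗ e_{i_n}`, which is indexed by the words `i : Fin n → ι`. -/
abbrev TensorPowerOp (ι : Type*) (n : ℕ) : Type _ := Matrix (Fin n → ι) (Fin n → ι) ℂ

/-- Density operators: positive semidefinite operators of unit trace. -/
def densityOps (κ : Type*) [Fintype κ] : Set (Matrix κ κ ℂ) :=
  {ρ | ρ.PosSemidef ∧ ρ.trace = 1}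

/-- The power `ρ ^ s` of a positive semidefinite operator for a real exponent `s ≠ 0`, through the
functional calculus (so `0 ^ s = 0` on the kernel of `ρ`). -/
def opPow {κ : Type*} [Fintype κ] [DecidableEq κ] (ρ : Matrix κ κ ℂ) (s : ℝ) : Matrix κ κ ℂ :=
  cfc (fun x : ℝ => x ^ s) ρ

/-- The Petz quasi-divergence `Q_α(ρ‖σ) = Tr[ρ ^ α σ ^ (1 - α)]` for `0 < α < 1`
(this trace is a nonnegative real number when `ρ` and `σ` are positive semidefinite). -/
def petzQ {κ : Type*} [Fintype κ] [DecidableEq κ] (α : ℝ) (ρ σ : Matrix κ κ ℂ) : ℝ :=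
  (opPow ρ α * opPow σ (1 - α)).trace.re

open Classical in
/-- The Petz Rényi divergence `D_α(ρ‖σ) = (α - 1)⁻¹ log₂ Q_α(ρ‖σ)` for `0 < α < 1`. As
`log 0 = -∞` and `α - 1 < 0`, its value is `+∞` when `Q_α(ρ‖σ) = 0`. -/
def petzDiv {κ : Type*} [Fintype κ] [DecidableEq κ] (α : ℝ) (ρ σ : Matrix κ κ ℂ) : EReal :=
  if petzQ α ρ σ = 0 then ⊤ else ((1 / (α - 1) * Real.logb 2 (petzQ α ρ σ) : ℝ) : EReal)

/-- The divergence between two sets of operators: the infimum over all pairs. -/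
def petzDivSets {κ : Type*} [Fintype κ] [DecidableEq κ] (α : ℝ) (A B : Set (Matrix κ κ ℂ)) :
    EReal :=
  ⨅ ρ ∈ A, ⨅ σ ∈ B, petzDiv α ρ σ

/-- The regularized divergence `D_α^∞(A‖B) = lim_{n → ∞} (1 / n) D_α(A_n‖B_n)` exists (as an
extended real number) and equals `L`. -/
def HasRegPetzDiv {ι : Type*} [Fintype ι] [DecidableEq ι] (α : ℝ)
    (A B : (n : ℕ) → Set (TensorPowerOp ι n)) (L : EReal) : Prop :=
  Tendsto (fun n : ℕ => ((1 / (n : ℝ) : ℝ) : EReal) * petzDivSets α (A n) (B n)) atTop (𝓝 L)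

/-- A choice, for every `n ≥ 1` and every parameter `α ∈ [0, 1]`, of a pair
`(ρ_n(α), σ_n(α)) ∈ A_n × B_n` which for `0 < α < 1` minimizes the Petz Rényi divergence of order
`α` up to the additive error `1`. (At `α = 0` and `α = 1` it is an arbitrary pair in
`A_n × B_n`.) -/
structure IsApproxMinimizerFamily {ι : Type*} [Fintype ι] [DecidableEq ι]
    (A B : (n : ℕ) → Set (TensorPowerOp ι n))
    (ρ σ : (n : ℕ) → ℝ → TensorPowerOp ι n) : Prop where
  mem_left : ∀ n : ℕ, 1 ≤ n → ∀ α ∈ Icc (0 : ℝ) 1, ρ n α ∈ A n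
  mem_right : ∀ n : ℕ, 1 ≤ n → ∀ α ∈ Icc (0 : ℝ) 1, σ n α ∈ B n
  le_add_one : ∀ n : ℕ, 1 ≤ n → ∀ α ∈ Ioo (0 : ℝ) 1,
    petzDiv α (ρ n α) (σ n α) ≤ petzDivSets α (A n) (B n) + 1

/-- The average `(1 / (n + 1)) ∑_{j = 0}^{n} ρ(j / n)` over the grid `j / n`. -/
def gridAverage {ι : Type*} (n : ℕ) (ρ : ℝ → TensorPowerOp ι n) : TensorPowerOp ι n :=
  (1 / ((n : ℝ) + 1)) • ∑ j ∈ Finset.range (n + 1), ρ ((j : ℝ) / (n : ℝ))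

end

/-! The lower bound is immediate: by convexity the averaged pair is a candidate in the infimum. For
the upper bound, one sequence must serve all orders at once, and a grid of only `n + 1` orders
suffices. The average dominates each of its terms with weight `1 / (n + 1)`. As `x ^ α` and `x ^ (1
- α)` are operator monotone and `petzQ` is jointly homogeneous of degree one, replacing a term by
the average costs at most `log₂ (n + 1) / (1 - α)` (`petzDiv_le_add_of_smul_le`), which is `o(n)`.
The divergence is nondecreasing in its order (`petzDiv_mono`), so the grid point just above `α` is
nearly optimal relative to any fixed order `γ > α` (`petzDiv_gridAverage_le`). Dividing by `n`
bounds the limit superior by `D γ`, and continuity at `α` lets `γ` decrease to `α`. -/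

section PetzDivergence

variable {κ : Type*} [Fintype κ] [DecidableEq κ]

/-! ### Spectral form of the quasi-divergence -/

/-- The trace of a product of two diagonalized matrices as a double sum. -/
theorem trace_conj_diagonal_mul_conj_diagonal (U V : Matrix κ κ ℂ) (d e : κ → ℝ) :
    ((U * Matrix.diagonal (fun i => (d i : ℂ)) * star U) *
      (V * Matrix.diagonal (fun i => (e i : ℂ)) * star V)).trace.re =
      ∑ p : κ × κ, Complex.normSq ((star V * U) p.2 p.1) * d p.1 * e p.2 := by
  have h : ((U * Matrix.diagonal (fun i => (d i : ℂ)) * star U) *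
      (V * Matrix.diagonal (fun i => (e i : ℂ)) * star V)).trace =
      ((star V * U) * Matrix.diagonal (fun i => (d i : ℂ)) * star (star V * U) *
        Matrix.diagonal (fun i => (e i : ℂ))).trace := by
    rw [← mul_assoc, Matrix.trace_mul_comm]
    simp only [star_mul, star_star, mul_assoc]
  rw [h, Matrix.trace, Complex.re_sum, Fintype.sum_prod_type, Finset.sum_comm]
  refine Finset.sum_congr rfl fun i _ => ?_
  rw [Matrix.diag_apply, Matrix.mul_diagonal, Matrix.mul_apply, Finset.sum_mul, Complex.re_sum]
  refine Finset.sum_congr rfl fun j _ => ?_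
  rw [Matrix.mul_diagonal, Matrix.star_apply]
  have : (star V * U) i j * (d j : ℂ) * star ((star V * U) i j) * (e i : ℂ) =
      ((Complex.normSq ((star V * U) i j) * d j * e i : ℝ) : ℂ) := by
    push_cast
    rw [Complex.normSq_eq_conj_mul_self]
    simp only [RCLike.star_def]
    ring
  rw [this, Complex.ofReal_re]

theorem opPow_eq_conj_diagonal {ρ : Matrix κ κ ℂ} (hρ : ρ.IsHermitian) (s : ℝ) :
    opPow ρ s = (hρ.eigenvectorUnitary : Matrix κ κ ℂ) *
      Matrix.diagonal (fun i => ((hρ.eigenvalues i ^ s : ℝ) : ℂ)) *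
      star (hρ.eigenvectorUnitary : Matrix κ κ ℂ) := by
  rw [opPow, hρ.cfc_eq, Matrix.IsHermitian.cfc, Unitary.conjStarAlgAut_apply]
  rfl

/-- The Petz quasi-divergence as a classical quasi-divergence of weighted eigenvalues. -/
theorem exists_petzQ_eq_sum {ρ σ : Matrix κ κ ℂ} (hρ : ρ.PosSemidef) (hσ : σ.PosSemidef) :
    ∃ (w l m : κ × κ → ℝ), (∀ p, 0 ≤ w p) ∧ (∀ p, 0 ≤ l p) ∧ (∀ p, 0 ≤ m p) ∧
      ∀ α : ℝ, petzQ α ρ σ = ∑ p, w p * l p ^ α * m p ^ (1 - α) := by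
  refine ⟨fun p => Complex.normSq ((star (hσ.1.eigenvectorUnitary : Matrix κ κ ℂ) *
      (hρ.1.eigenvectorUnitary : Matrix κ κ ℂ)) p.2 p.1), fun p => hρ.1.eigenvalues p.1, fun p => hσ.1.eigenvalues p.2,
    fun p => Complex.normSq_nonneg _, fun p => hρ.eigenvalues_nonneg _,
    fun p => hσ.eigenvalues_nonneg _, fun α => ?_⟩
  rw [petzQ, opPow_eq_conj_diagonal hρ.1, opPow_eq_conj_diagonal hσ.1]
  exact trace_conj_diagonal_mul_conj_diagonal _ _ _ _

theorem opPow_one {ρ : Matrix κ κ ℂ} (hρ : ρ.PosSemidef) : opPow ρ 1 = ρ := by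
  simp only [opPow, Real.rpow_one]
  exact cfc_id' ℝ ρ hρ.1

/-- Since `0 ^ 0 = 1`, the zeroth power is the identity and not the support projection, so the
endpoint values of `petzQ` are plain traces. -/
theorem opPow_zero {ρ : Matrix κ κ ℂ} (hρ : ρ.PosSemidef) : opPow ρ 0 = 1 := by
  simp only [opPow, Real.rpow_zero]
  exact cfc_const_one ℝ ρ hρ.1

theorem petzQ_zero {ρ σ : Matrix κ κ ℂ} (hρ : ρ.PosSemidef) (hσ : σ.PosSemidef) :
    petzQ 0 ρ σ = σ.trace.re := by
  simp [petzQ, opPow_zero hρ, opPow_one hσ]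

theorem petzQ_one {ρ σ : Matrix κ κ ℂ} (hρ : ρ.PosSemidef) (hσ : σ.PosSemidef) :
    petzQ 1 ρ σ = ρ.trace.re := by
  simp [petzQ, opPow_zero hσ, opPow_one hρ]

theorem petzQ_nonneg {ρ σ : Matrix κ κ ℂ} (hρ : ρ.PosSemidef) (hσ : σ.PosSemidef) (α : ℝ) :
    0 ≤ petzQ α ρ σ := by
  obtain ⟨w, l, m, hw, hl, hm, h⟩ := exists_petzQ_eq_sum hρ hσ
  rw [h]
  exact Finset.sum_nonneg fun p _ => mul_nonneg (mul_nonneg (hw p) (Real.rpow_nonneg (hl p) _))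
    (Real.rpow_nonneg (hm p) _)

/-! ### Dependence on the order -/

/-- Log-convexity of `α ↦ Q_α` between `α` and `1`, for a normalized first argument. -/
theorem petzQ_le_rpow_petzQ {ρ σ : Matrix κ κ ℂ} (hρ : ρ ∈ densityOps κ) (hσ : σ.PosSemidef)
    {α β : ℝ} (hα : 0 ≤ α) (hαβ : α < β) (hβ : β < 1) :
    petzQ β ρ σ ≤ petzQ α ρ σ ^ ((1 - β) / (1 - α)) := by
  obtain ⟨w, l, m, hw, hl, hm, h⟩ := exists_petzQ_eq_sum hρ.1 hσ
  have hβ' : 0 < 1 - β := by linarith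
  have hα' : 0 < 1 - α := by linarith
  have hp : 1 ≤ (1 - α) / (1 - β) := by rw [le_div_iff₀ hβ']; linarith
  have h1 : ∑ p, w p * l p = 1 := by
    have := petzQ_one hρ.1 hσ
    rw [h, hρ.2] at this
    simpa using this
  have hf : ∀ p, 0 ≤ (m p / l p) ^ (1 - β) :=
    fun p => Real.rpow_nonneg (div_nonneg (hm p) (hl p)) _
  -- Hölder for the probability weights `w * l`: raising `(m / l) ^ (1 - β)` to the power `(1 - α) /
  -- (1 - β)` gives `(m / l) ^ (1 - α)`.
  have key := Real.inner_le_weight_mul_Lp_of_nonneg Finset.univ hp (fun p => w p * l p)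
    (fun p => (m p / l p) ^ (1 - β)) (fun p => mul_nonneg (hw p) (hl p)) hf
  rw [h1, Real.one_rpow, one_mul, inv_div] at key
  have term : ∀ (s : ℝ) (p), 0 < l p →
      w p * l p * (m p / l p) ^ (1 - s) = w p * l p ^ s * m p ^ (1 - s) := by
    intro s p hl'
    rw [Real.div_rpow (hm p) (hl p), Real.rpow_sub hl' 1 s, Real.rpow_one]
    have := (Real.rpow_pos_of_pos hl' s).ne'
    field_simp
  calc petzQ β ρ σ ≤ ∑ p, w p * l p * (m p / l p) ^ (1 - β) := by
        rw [h]
        refine Finset.sum_le_sum fun p _ => ?_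
        rcases (hl p).eq_or_lt with h0 | h0
        · simp [← h0, Real.zero_rpow (hα.trans_lt hαβ).ne']
        · rw [term β p h0]
    _ ≤ _ := key
    _ ≤ petzQ α ρ σ ^ ((1 - β) / (1 - α)) := by
        refine Real.rpow_le_rpow (Finset.sum_nonneg fun p _ => mul_nonneg
          (mul_nonneg (hw p) (hl p)) (Real.rpow_nonneg (hf p) _)) ?_ (by positivity)
        rw [h]
        refine Finset.sum_le_sum fun p _ => ?_
        rw [← Real.rpow_mul (div_nonneg (hm p) (hl p)), mul_div_cancel₀ _ hβ'.ne']
        -- Only an inequality holds where `l p = 0`: for `α = 0` the right-hand term can be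
        -- positive.
        rcases (hl p).eq_or_lt with h0 | h0
        · rw [← h0, mul_zero, zero_mul]
          exact mul_nonneg (mul_nonneg (hw p) (Real.rpow_nonneg le_rfl _))
            (Real.rpow_nonneg (hm p) _)
        · rw [term α p h0]

theorem petzQ_le_one {ρ σ : Matrix κ κ ℂ} (hρ : ρ ∈ densityOps κ) (hσ : σ ∈ densityOps κ)
    {α : ℝ} (hα : α ∈ Ioo (0 : ℝ) 1) : petzQ α ρ σ ≤ 1 := by
  -- Compare with order `0`, where the quasi-divergence is `Tr σ = 1`.
  have h := petzQ_le_rpow_petzQ hρ hσ.1 le_rfl hα.1 hα.2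
  rwa [petzQ_zero hρ.1 hσ.1, hσ.2, Complex.one_re, Real.one_rpow] at h

theorem petzDiv_nonneg {ρ σ : Matrix κ κ ℂ} (hρ : ρ ∈ densityOps κ) (hσ : σ ∈ densityOps κ)
    {α : ℝ} (hα : α ∈ Ioo (0 : ℝ) 1) : 0 ≤ petzDiv α ρ σ := by
  rw [petzDiv]
  split_ifs with h
  · exact le_top
  · rw [EReal.coe_nonneg]
    refine mul_nonneg_of_nonpos_of_nonpos ?_ ?_
    · exact div_nonpos_of_nonneg_of_nonpos zero_le_one (by linarith [hα.2])
    · exact Real.logb_nonpos one_lt_two (petzQ_nonneg hρ.1 hσ.1 _) (petzQ_le_one hρ hσ hα)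

theorem petzDivSets_nonneg {A B : Set (Matrix κ κ ℂ)} (hA : A ⊆ densityOps κ)
    (hB : B ⊆ densityOps κ) {α : ℝ} (hα : α ∈ Ioo (0 : ℝ) 1) : 0 ≤ petzDivSets α A B :=
  le_iInf₂ fun _ hρ => le_iInf₂ fun _ hσ => petzDiv_nonneg (hA hρ) (hB hσ) hα

theorem petzDivSets_le {A B : Set (Matrix κ κ ℂ)} {ρ σ : Matrix κ κ ℂ} (hρ : ρ ∈ A) (hσ : σ ∈ B)
    (α : ℝ) : petzDivSets α A B ≤ petzDiv α ρ σ :=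
  (iInf₂_le ρ hρ).trans (iInf₂_le σ hσ)

theorem petzDivSets_singleton (α : ℝ) (ρ σ : Matrix κ κ ℂ) :
    petzDivSets α {ρ} {σ} = petzDiv α ρ σ := by
  simp [petzDivSets]

/-- A lower bound on the quasi-divergence up to a power and a factor gives an upper bound on the
Rényi divergence. -/
theorem petzDiv_le_add_of_mul_rpow_le {ρ σ ρ' σ' : Matrix κ κ ℂ} {α β c : ℝ} (hα : α < 1)
    (hβ : β < 1) (hc : 0 < c) (h0 : 0 ≤ petzQ β ρ' σ')
    (h : c * petzQ β ρ' σ' ^ ((1 - α) / (1 - β)) ≤ petzQ α ρ σ) :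
    petzDiv α ρ σ ≤ petzDiv β ρ' σ' + ((1 / (α - 1) * Real.logb 2 c : ℝ) : EReal) := by
  by_cases hβ0 : petzQ β ρ' σ' = 0
  · rw [petzDiv, petzDiv, if_pos hβ0, EReal.top_add_coe]
    exact le_top
  have hpos : 0 < petzQ β ρ' σ' := lt_of_le_of_ne h0 (Ne.symm hβ0)
  have hr : 0 < petzQ β ρ' σ' ^ ((1 - α) / (1 - β)) := Real.rpow_pos_of_pos hpos _
  have hα0 : 0 < petzQ α ρ σ := (mul_pos hc hr).trans_le h
  rw [petzDiv, petzDiv, if_neg hβ0, if_neg hα0.ne', ← EReal.coe_add, EReal.coe_le_coe_iff]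
  have hl := Real.logb_le_logb_of_le one_lt_two (mul_pos hc hr) h
  rw [Real.logb_mul hc.ne' hr.ne', Real.logb_rpow_eq_mul_logb_of_pos hpos] at hl
  have hneg : 1 / (α - 1) ≤ 0 := div_nonpos_of_nonneg_of_nonpos zero_le_one (by linarith)
  have := mul_le_mul_of_nonpos_left hl hneg
  have e : 1 / (α - 1) * (Real.logb 2 c + (1 - α) / (1 - β) * Real.logb 2 (petzQ β ρ' σ')) =
      1 / (β - 1) * Real.logb 2 (petzQ β ρ' σ') + 1 / (α - 1) * Real.logb 2 c := by
    have h1 : α - 1 ≠ 0 := by linarith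
    have h2 : β - 1 ≠ 0 := by linarith
    have h3 : 1 - β ≠ 0 := by linarith
    field_simp
    ring
  linarith

/-- The Petz Rényi divergence is nondecreasing in its order. -/
theorem petzDiv_mono {ρ σ : Matrix κ κ ℂ} (hρ : ρ ∈ densityOps κ) (hσ : σ ∈ densityOps κ)
    {α β : ℝ} (hα : 0 < α) (hαβ : α ≤ β) (hβ : β < 1) : petzDiv α ρ σ ≤ petzDiv β ρ σ := by
  rcases hαβ.eq_or_lt with rfl | hlt
  · exact le_rfl
  have hα' : 0 < 1 - α := by linarith
  have hβ' : 0 < 1 - β := by linarith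
  have h := petzDiv_le_add_of_mul_rpow_le (ρ := ρ) (σ := σ) (ρ' := ρ) (σ' := σ) (c := 1)
    (hαβ.trans_lt hβ) hβ one_pos (petzQ_nonneg hρ.1 hσ.1 _) ?_
  · simpa using h
  · have hq := Real.rpow_le_rpow (petzQ_nonneg hρ.1 hσ.1 _)
      (petzQ_le_rpow_petzQ hρ hσ.1 hα.le hlt hβ) (div_nonneg hα'.le hβ'.le)
    rw [← Real.rpow_mul (petzQ_nonneg hρ.1 hσ.1 _)] at hq
    rwa [div_mul_div_cancel₀ hα'.ne', div_self hβ'.ne', Real.rpow_one, ← one_mul (_ ^ _)] at hq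

theorem petzDivSets_mono {A B : Set (Matrix κ κ ℂ)} (hA : A ⊆ densityOps κ)
    (hB : B ⊆ densityOps κ) {α β : ℝ} (hα : 0 < α) (hαβ : α ≤ β) (hβ : β < 1) :
    petzDivSets α A B ≤ petzDivSets β A B :=
  iInf₂_mono fun _ hρ => iInf₂_mono fun _ hσ => petzDiv_mono (hA hρ) (hB hσ) hα hαβ hβ

/-- The infimum defining the divergence of two nonempty sets is attained up to the error `1`. -/
theorem exists_petzDiv_le_add_one {A B : Set (Matrix κ κ ℂ)} (hA : A ⊆ densityOps κ)
    (hB : B ⊆ densityOps κ) (hA_ne : A.Nonempty) (hB_ne : B.Nonempty) {α : ℝ}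
    (hα : α ∈ Ioo (0 : ℝ) 1) :
    ∃ ρ ∈ A, ∃ σ ∈ B, petzDiv α ρ σ ≤ petzDivSets α A B + 1 := by
  by_contra! hcon
  obtain ⟨ρ, hρ⟩ := hA_ne
  obtain ⟨σ, hσ⟩ := hB_ne
  have h1 : petzDivSets α A B + 1 ≤ petzDivSets α A B :=
    le_iInf₂ fun ρ hρ => le_iInf₂ fun σ hσ => (hcon ρ hρ σ hσ).le
  have h0 : petzDivSets α A B ≠ ⊥ :=
    ne_bot_of_le_ne_bot EReal.zero_ne_bot (petzDivSets_nonneg hA hB hα)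
  have ht : petzDivSets α A B ≠ ⊤ := fun h => by
    have := hcon ρ hρ σ hσ
    rw [h, EReal.top_add_of_ne_bot (by decide)] at this
    exact not_top_lt this
  lift petzDivSets α A B to ℝ using ⟨ht, h0⟩ with x
  have h2 : x + 1 ≤ x := by exact_mod_cast h1
  linarith

/-! ### Homogeneity and operator monotonicity -/

theorem petzQ_smul {ρ σ : Matrix κ κ ℂ} (hρ : ρ.PosSemidef) (hσ : σ.PosSemidef) {c : ℝ}
    (hc : 0 < c) (α : ℝ) : petzQ α (c • ρ) (c • σ) = c * petzQ α ρ σ := by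
  have aux : ∀ {τ : Matrix κ κ ℂ}, τ.PosSemidef → ∀ s : ℝ,
      opPow (c • τ) s = c ^ s • opPow τ s := by
    intro τ hτ s
    have hfin : (spectrum ℝ τ).Finite := Matrix.finite_real_spectrum
    have hc1 : ContinuousOn (fun x : ℝ => x ^ s) (spectrum ℝ τ) := hfin.continuousOn _
    rw [opPow, opPow, ← cfc_smul _ _ _ hc1]
    refine (cfc_comp_smul c (fun x : ℝ => x ^ s) τ ((hfin.image _).continuousOn _) hτ.1).symm.trans
      (cfc_congr fun x hx => ?_)
    have hx0 : 0 ≤ x := by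
      rw [hτ.1.spectrum_real_eq_range_eigenvalues] at hx
      obtain ⟨i, rfl⟩ := hx
      exact hτ.eigenvalues_nonneg i
    simp [Real.mul_rpow hc.le hx0]
  rw [petzQ, petzQ, aux hρ, aux hσ, smul_mul_smul_comm, ← Real.rpow_add hc]
  simp

-- This is the Löwner–Heinz inequality, hence the restriction to exponents in `[0, 1]`.
open scoped MatrixOrder Matrix.Norms.L2Operator in
theorem opPow_mono {ρ ρ' : Matrix κ κ ℂ} (hρ : ρ.PosSemidef) (h : (ρ' - ρ).PosSemidef) {s : ℝ}
    (hs : s ∈ Icc (0 : ℝ) 1) : (opPow ρ s).PosSemidef ∧ (opPow ρ' s - opPow ρ s).PosSemidef := by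
  have h0 : 0 ≤ ρ := Matrix.nonneg_iff_posSemidef.2 hρ
  have hle : ρ ≤ ρ' := Matrix.le_iff.2 h
  have e : opPow ρ s = ρ ^ s := (CFC.rpow_eq_cfc_real h0).symm
  have e' : opPow ρ' s = ρ' ^ s := (CFC.rpow_eq_cfc_real (h0.trans hle)).symm
  rw [e, e']
  exact ⟨Matrix.nonneg_iff_posSemidef.1 CFC.rpow_nonneg, Matrix.le_iff.1 (CFC.rpow_le_rpow hs hle)⟩

open scoped MatrixOrder in
theorem Matrix.PosSemidef.trace_mul_re_nonneg {X Y : Matrix κ κ ℂ} (hX : X.PosSemidef)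
    (hY : Y.PosSemidef) : 0 ≤ (X * Y).trace.re := by
  obtain ⟨C, rfl⟩ := CStarAlgebra.nonneg_iff_eq_star_mul_self.1 (Matrix.nonneg_iff_posSemidef.2 hY)
  rw [← mul_assoc, Matrix.trace_mul_comm, ← mul_assoc]
  exact (Complex.nonneg_iff.1 (hX.mul_mul_conjTranspose_same C).trace_nonneg).1

theorem petzQ_mono {ρ ρ' σ σ' : Matrix κ κ ℂ} (hρ : ρ.PosSemidef) (hσ : σ.PosSemidef)
    (hρ' : (ρ' - ρ).PosSemidef) (hσ' : (σ' - σ).PosSemidef) {α : ℝ} (hα : α ∈ Ioo (0 : ℝ) 1) :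
    petzQ α ρ σ ≤ petzQ α ρ' σ' := by
  obtain ⟨hX, hX'⟩ := opPow_mono hρ hρ' (s := α) ⟨hα.1.le, hα.2.le⟩
  obtain ⟨hY, hY'⟩ := opPow_mono hσ hσ' (s := 1 - α) ⟨by linarith [hα.2], by linarith [hα.1]⟩
  -- Telescope: `Tr X'Y' - Tr XY = Tr (X' - X)Y + Tr X'(Y' - Y)`.
  have h1 := hX'.trace_mul_re_nonneg hY
  have h2 := (hX.add hX').trace_mul_re_nonneg hY'
  rw [add_sub_cancel, mul_sub, Matrix.trace_sub, Complex.sub_re] at h2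
  rw [sub_mul, Matrix.trace_sub, Complex.sub_re] at h1
  rw [petzQ, petzQ]
  linarith

/-- Passing from a pair of states to a pair of states that dominates it up to a factor `c`
increases the Rényi divergence by at most a constant. -/
theorem petzDiv_le_add_of_smul_le {ρ ρ' σ σ' : Matrix κ κ ℂ} (hρ : ρ.PosSemidef)
    (hσ : σ.PosSemidef) {c : ℝ} (hc : 0 < c) (hρ' : (ρ' - c • ρ).PosSemidef)
    (hσ' : (σ' - c • σ).PosSemidef) {α : ℝ} (hα : α ∈ Ioo (0 : ℝ) 1) :
    petzDiv α ρ' σ' ≤ petzDiv α ρ σ + ((1 / (α - 1) * Real.logb 2 c : ℝ) : EReal) := by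
  refine petzDiv_le_add_of_mul_rpow_le hα.2 hα.2 hc (petzQ_nonneg hρ hσ α) ?_
  rw [div_self (by linarith [hα.2]), Real.rpow_one, ← petzQ_smul hρ hσ hc]
  exact petzQ_mono (hρ.smul hc.le) (hσ.smul hc.le) hρ' hσ' hα

end PetzDivergence

/-! ### Averages over the grid of orders -/

section GridAverage

theorem grid_mem_Icc {n j : ℕ} (hj : j ∈ Finset.range (n + 1)) :
    (j : ℝ) / (n : ℝ) ∈ Icc (0 : ℝ) 1 := by
  have : (j : ℝ) ≤ n := by exact_mod_cast Nat.lt_succ_iff.1 (Finset.mem_range.1 hj)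
  exact ⟨by positivity, div_le_one_of_le₀ this (Nat.cast_nonneg n)⟩

theorem gridAverage_mem {ι : Type*} {n : ℕ} {S : Set (TensorPowerOp ι n)} (hS : Convex ℝ S)
    {ρ : ℝ → TensorPowerOp ι n} (hρ : ∀ α ∈ Icc (0 : ℝ) 1, ρ α ∈ S) : gridAverage n ρ ∈ S := by
  rw [gridAverage, Finset.smul_sum]
  refine hS.sum_mem (fun _ _ => by positivity) ?_ fun j hj => hρ _ (grid_mem_Icc hj)
  rw [Finset.sum_const, Finset.card_range, nsmul_eq_mul]
  push_cast
  exact mul_one_div_cancel (by positivity)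

/-- The average over the grid dominates each of its terms with its weight. -/
theorem posSemidef_gridAverage_sub {ι : Type*} {n : ℕ}
    {ρ : ℝ → TensorPowerOp ι n}
    (hρ : ∀ α ∈ Icc (0 : ℝ) 1, (ρ α).PosSemidef) {j : ℕ} (hj : j ∈ Finset.range (n + 1)) :
    (gridAverage n ρ - (1 / ((n : ℝ) + 1)) • ρ ((j : ℝ) / (n : ℝ))).PosSemidef := by
  rw [gridAverage, ← smul_sub, ← Finset.add_sum_erase _ _ hj, add_sub_cancel_left]
  refine Matrix.PosSemidef.smul (Matrix.posSemidef_sum _ fun i hi => ?_) (by positivity)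
  exact hρ _ (grid_mem_Icc (Finset.mem_of_mem_erase hi))

variable {ι : Type*} [Fintype ι] [DecidableEq ι]

theorem exists_isApproxMinimizerFamily {A B : (n : ℕ) → Set (TensorPowerOp ι n)}
    (hA : ∀ n : ℕ, 1 ≤ n → A n ⊆ densityOps (Fin n → ι))
    (hB : ∀ n : ℕ, 1 ≤ n → B n ⊆ densityOps (Fin n → ι))
    (hA_ne : ∀ n : ℕ, 1 ≤ n → (A n).Nonempty) (hB_ne : ∀ n : ℕ, 1 ≤ n → (B n).Nonempty) :
    ∃ ρ σ : (n : ℕ) → ℝ → TensorPowerOp ι n, IsApproxMinimizerFamily A B ρ σ := by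
  have h : ∀ (n : ℕ) (α : ℝ), ∃ ρ σ : TensorPowerOp ι n, 1 ≤ n → ρ ∈ A n ∧ σ ∈ B n ∧
      (α ∈ Ioo (0 : ℝ) 1 → petzDiv α ρ σ ≤ petzDivSets α (A n) (B n) + 1) := by
    intro n α
    by_cases hn : 1 ≤ n
    · by_cases hα : α ∈ Ioo (0 : ℝ) 1
      · obtain ⟨ρ, hρ, σ, hσ, h⟩ := exists_petzDiv_le_add_one (hA n hn) (hB n hn) (hA_ne n hn)
          (hB_ne n hn) hα
        exact ⟨ρ, σ, fun _ => ⟨hρ, hσ, fun _ => h⟩⟩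
      · obtain ⟨ρ, hρ⟩ := hA_ne n hn
        obtain ⟨σ, hσ⟩ := hB_ne n hn
        exact ⟨ρ, σ, fun _ => ⟨hρ, hσ, fun h => absurd h hα⟩⟩
    · exact ⟨0, 0, fun h => absurd h hn⟩
  choose ρ σ h using h
  exact ⟨ρ, σ, fun n hn α _ => (h n α hn).1, fun n hn α _ => (h n α hn).2.1,
    fun n hn α hα => (h n α hn).2.2 hα⟩

/-- The averaged pair is almost optimal at order `α` when compared with the divergence of the sets
at any order that exceeds `α` by at least the mesh of the grid. -/
theorem petzDiv_gridAverage_le {A B : (n : ℕ) → Set (TensorPowerOp ι n)}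
    {ρ σ : (n : ℕ) → ℝ → TensorPowerOp ι n} (h : IsApproxMinimizerFamily A B ρ σ) {n : ℕ}
    (hn : 1 ≤ n) (hA : A n ⊆ densityOps (Fin n → ι)) (hB : B n ⊆ densityOps (Fin n → ι))
    {α γ : ℝ} (hα : α ∈ Ioo (0 : ℝ) 1) (hγ : γ < 1) (hαγ : α + 1 / (n : ℝ) ≤ γ) :
    petzDiv α (gridAverage n (ρ n)) (gridAverage n (σ n)) ≤ petzDivSets γ (A n) (B n) +
      ((1 + 1 / (1 - α) * Real.logb 2 ((n : ℝ) + 1) : ℝ) : EReal) := by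
  have hn0 : (0 : ℝ) < n := by exact_mod_cast hn
  -- Round up: the divergence grows with the order, so near-optimality at a grid point `β ≥ α`
  -- transfers down to `α`.
  set j := ⌈α * n⌉₊ with hj
  set β : ℝ := (j : ℝ) / (n : ℝ) with hβ
  have hαβ : α ≤ β := by rw [hβ, le_div_iff₀ hn0]; exact Nat.le_ceil _
  have hβγ : β ≤ γ := by
    refine le_trans ?_ hαγ
    rw [hβ, div_le_iff₀ hn0, add_mul, one_div_mul_cancel hn0.ne']
    exact (Nat.ceil_lt_add_one (mul_pos hα.1 hn0).le).le
  -- This keeps `β` off the endpoint `1`, where the chosen pair is arbitrary.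
  have hβ1 : β < 1 := hβγ.trans_lt hγ
  have hβ0 : 0 < β := hα.1.trans_le hαβ
  have hjn : j ∈ Finset.range (n + 1) := by
    rw [hβ, div_lt_one hn0] at hβ1
    have : j < n := by exact_mod_cast hβ1
    exact Finset.mem_range.2 (by omega)
  have hρd := fun x hx => hA (h.mem_left n hn x hx)
  have hσd := fun x hx => hB (h.mem_right n hn x hx)
  have hβI : β ∈ Icc (0 : ℝ) 1 := ⟨hβ0.le, hβ1.le⟩
  have h1 := petzDiv_le_add_of_smul_le (hρd β hβI).1 (hσd β hβI).1
    (c := 1 / ((n : ℝ) + 1)) (by positivity)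
    (posSemidef_gridAverage_sub (fun x hx => (hρd x hx).1) hjn)
    (posSemidef_gridAverage_sub (fun x hx => (hσd x hx).1) hjn) hα
  have h2 : petzDiv α (ρ n β) (σ n β) ≤ petzDivSets γ (A n) (B n) + 1 :=
    (petzDiv_mono (hρd β hβI) (hσd β hβI) hα.1 hαβ hβ1).trans <|
      (h.le_add_one n hn β ⟨hβ0, hβ1⟩).trans <|
        add_le_add_left (petzDivSets_mono hA hB hβ0 hβγ hγ) 1
  have e : 1 / (α - 1) * Real.logb 2 (1 / ((n : ℝ) + 1)) =
      1 / (1 - α) * Real.logb 2 ((n : ℝ) + 1) := by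
    rw [one_div ((n : ℝ) + 1), Real.logb_inv, ← neg_sub 1 α, one_div_neg_eq_neg_one_div]
    ring
  rw [e] at h1
  rw [EReal.coe_add, ← add_assoc]
  exact h1.trans (add_le_add_left h2 _)

theorem tendsto_one_div_mul_logb_add_one (c : ℝ) :
    Tendsto (fun n : ℕ => 1 / (n : ℝ) * (1 + c * Real.logb 2 ((n : ℝ) + 1))) atTop (𝓝 0) := by
  have h1 : Tendsto (fun n : ℕ => (n : ℝ) + 1) atTop atTop :=
    tendsto_atTop_add_const_right _ _ tendsto_natCast_atTop_atTop
  -- At `x = n + 1` the denominator `1 * x + (-1)` is exactly `n`.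
  have h2 := ((Real.tendsto_pow_log_div_mul_add_atTop 1 (-1) 1 one_ne_zero).comp h1).const_mul
    (c / Real.log 2)
  have h3 := tendsto_one_div_atTop_nhds_zero_nat (𝕜 := ℝ) |>.add h2
  rw [mul_zero, add_zero] at h3
  refine h3.congr fun n => ?_
  simp only [Function.comp_apply, pow_one, one_mul, add_neg_cancel_right, Real.logb]
  ring

/-- The averaged pairs attain the regularized divergence at every point of continuity. -/
theorem hasRegPetzDiv_gridAverage {A B : (n : ℕ) → Set (TensorPowerOp ι n)}
    (hA : ∀ n : ℕ, 1 ≤ n → A n ⊆ densityOps (Fin n → ι))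
    (hB : ∀ n : ℕ, 1 ≤ n → B n ⊆ densityOps (Fin n → ι))
    {ρ σ : (n : ℕ) → ℝ → TensorPowerOp ι n} (h : IsApproxMinimizerFamily A B ρ σ)
    (hmem : ∀ n : ℕ, 1 ≤ n → gridAverage n (ρ n) ∈ A n ∧ gridAverage n (σ n) ∈ B n)
    {α : ℝ} (hα : α ∈ Ioo (0 : ℝ) 1) {D : ℝ → EReal}
    (hD : ∀ᶠ β in 𝓝 α, HasRegPetzDiv β A B (D β)) (hcont : ContinuousAt D α) :
    HasRegPetzDiv α (fun n => {gridAverage n (ρ n)}) (fun n => {gridAverage n (σ n)}) (D α) := by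
  have hn0 : ∀ n : ℕ, (0 : EReal) ≤ ((1 / (n : ℝ) : ℝ) : EReal) := fun n =>
    EReal.coe_nonneg.2 (by positivity)
  simp only [HasRegPetzDiv, petzDivSets_singleton]
  refine tendsto_order.2 ⟨fun a ha => ?_, fun b hb => ?_⟩
  · filter_upwards [(tendsto_order.1 hD.self_of_nhds).1 a ha, eventually_ge_atTop 1] with n hna hn
    exact hna.trans_le (mul_le_mul_of_nonneg_left
      (petzDivSets_le (hmem n hn).1 (hmem n hn).2 α) (hn0 n))
  -- Continuity gives an order `γ > α` with `D γ < b`; the mesh `1 / n` eventually fits into the gap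
  -- `γ - α`.
  · obtain ⟨γ, ⟨⟨hγD, hγb⟩, hγ1⟩, hαγ⟩ := ((((hD.and (hcont.eventually_lt_const hb)).and
      (eventually_lt_nhds hα.2)).filter_mono nhdsWithin_le_nhds).and
        (self_mem_nhdsWithin : Ioi α ∈ 𝓝[>] α)).exists
    have hαγ : α < γ := hαγ
    have hr : Tendsto (fun n : ℕ => ((1 / (n : ℝ) *
        (1 + 1 / (1 - α) * Real.logb 2 ((n : ℝ) + 1)) : ℝ) : EReal)) atTop (𝓝 (0 : ℝ)) :=
      (continuous_coe_real_ereal.tendsto 0).comp (tendsto_one_div_mul_logb_add_one _)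
    have hsum : Tendsto (fun n : ℕ => ((1 / (n : ℝ) : ℝ) : EReal) * petzDivSets γ (A n) (B n) +
        ((1 / (n : ℝ) * (1 + 1 / (1 - α) * Real.logb 2 ((n : ℝ) + 1)) : ℝ) : EReal))
        atTop (𝓝 (D γ + (0 : ℝ))) :=
      -- Addition is continuous here even if `D γ` is infinite, because the other summand is finite.
      (EReal.continuousAt_add (p := (D γ, ((0 : ℝ) : EReal))) (Or.inr (EReal.coe_ne_bot 0))
        (Or.inr (EReal.coe_ne_top 0))).tendsto.comp (hγD.prodMk_nhds hr)
    rw [EReal.coe_zero, add_zero] at hsum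
    filter_upwards [hsum.eventually_lt_const hγb, eventually_ge_atTop 1,
      (tendsto_one_div_atTop_nhds_zero_nat (𝕜 := ℝ)).eventually_lt_const (sub_pos.2 hαγ)]
      with n hnb hn hnγ
    refine lt_of_le_of_lt ?_ hnb
    rw [EReal.coe_mul (1 / (n : ℝ)), ← EReal.left_distrib_of_nonneg_of_ne_top (hn0 n)
      (EReal.coe_ne_top _)]
    exact mul_le_mul_of_nonneg_left (petzDiv_gridAverage_le h hn (hA n hn) (hB n hn) hα hγ1
      (by linarith)) (hn0 n)

end GridAverage

theorem mainTheorem11 {ι : Type*} [Fintype ι] [DecidableEq ι]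
    (A B : (n : ℕ) → Set (TensorPowerOp ι n))
    (hA : ∀ n : ℕ, 1 ≤ n → A n ⊆ densityOps (Fin n → ι))
    (hB : ∀ n : ℕ, 1 ≤ n → B n ⊆ densityOps (Fin n → ι))
    (hA_ne : ∀ n : ℕ, 1 ≤ n → (A n).Nonempty)
    (hB_ne : ∀ n : ℕ, 1 ≤ n → (B n).Nonempty)
    (hA_conv : ∀ n : ℕ, 1 ≤ n → Convex ℝ (A n))
    (hB_conv : ∀ n : ℕ, 1 ≤ n → Convex ℝ (B n)) :
    (∃ ρ σ : (n : ℕ) → ℝ → TensorPowerOp ι n, IsApproxMinimizerFamily A B ρ σ) ∧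
    ∀ ρ σ : (n : ℕ) → ℝ → TensorPowerOp ι n, IsApproxMinimizerFamily A B ρ σ →
      (∀ n : ℕ, 1 ≤ n → gridAverage n (ρ n) ∈ A n ∧ gridAverage n (σ n) ∈ B n) ∧
      ∀ α ∈ Ioo (0 : ℝ) 1, ∀ D : ℝ → EReal,
        (∀ᶠ β in 𝓝 α, HasRegPetzDiv β A B (D β)) → ContinuousAt D α →
          HasRegPetzDiv α (fun n => {gridAverage n (ρ n)}) (fun n => {gridAverage n (σ n)}) (D α)
  := by
  refine ⟨exists_isApproxMinimizerFamily hA hB hA_ne hB_ne, fun ρ σ h => ?_⟩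
  have hmem : ∀ n : ℕ, 1 ≤ n → gridAverage n (ρ n) ∈ A n ∧ gridAverage n (σ n) ∈ B n :=
    fun n hn => ⟨gridAverage_mem (hA_conv n hn) (h.mem_left n hn),
      gridAverage_mem (hB_conv n hn) (h.mem_right n hn)⟩
  exact ⟨hmem, fun α hα D hD hcont => hasRegPetzDiv_gridAverage hA hB h hmem hα hD hcont⟩
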